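/- For $a,q\in\mathbb{C}$ with $|q|<1$ write $(a;q)_n=\prod_{k=0}^{n-1}(1-aq^k)$, $(a;q)_\infty=\prod_{k=0}^{\infty}(1-aq^k)$, and $(a_1,\dots,a_s;q)_n=(a_1;q)_n\cdots(a_s;q)_n$ for $n\in\{0,1,2,\dots\}\cup\{\infty\}$. Let $f(a,b)=\sum_{j=-\infty}^{\infty}a^{j(j+1)/2}b^{j(j-1)/2}$ be Ramanujan's theta function and $\psi(q)=f(q,q^3)$. Theorem. Let $z,q\in\mathbb{C}$ with $z,q\neq 0$ and $|q|<1$. For each positive integer $m$, all of the following infinite series converge absolutely and $$\sum_{r=0}^{m-1}q^{2r^2}z^r\sum_{n=0}^{\infty}\frac{q^{m^2n^2}\left(-q^{m^2}z^mq^{4mr},\,\dfrac{-q^{m^2}}{z^mq^{4mr}};\,q^{2m^2}\right)_n}{(q^{m^2};q^{2m^2})_n\,(q^{4m^2};q^{4m^2})_n}=\left(-zq^2,-q^2/z,q^4;q^4\right)_\infty\frac{(-q^{m^2};q^{2m^2})_\infty}{(q^{2m^2};q^{2m^2})_\infty}.$$ In particular, the case $m=1$ is Ramanujan's identity $$\sum_{n=0}^{\infty}\frac{q^{n^2}(-zq;q^2)_n(-q/z;q^2)_n}{(q;q^2)_n(q^4;q^4)_n}=\frac{f(zq^2,q^2/z)}{\psi(-q)}.$$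 -/

import Mathlib

noncomputable section

/-- The finite rising `q`-factorial `(a; q)_n = (1 - a) (1 - a q) ⋯ (1 - a q ^ (n - 1))`. -/
def qFactorial (a q : ℂ) (n : ℕ) : ℂ :=
  ∏ k ∈ Finset.range n, (1 - a * q ^ k)

/-- The infinite rising `q`-factorial `(a; q)_∞ = (1 - a) (1 - a q) (1 - a q ^ 2) ⋯`. -/
def qFactorialInf (a q : ℂ) : ℂ :=
  ∏' k : ℕ, (1 - a * q ^ k)

/-- The infinite product `(a; q)_∞` converges when `|q| < 1`. -/
theorem multipliable_qFactorialInf (a q : ℂ) (hq : ‖q‖ < 1) :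
    Multipliable fun k : ℕ => 1 - a * q ^ k := by
  have h : Summable fun k : ℕ => -(a * q ^ k) :=
    ((summable_geometric_of_norm_lt_one hq).mul_left a).neg
  simpa [sub_eq_add_neg] using Complex.multipliable_one_add_of_summable h

/-- Ramanujan's theta function `f(a, b)`, the sum over all integers `j` of
`a ^ (j (j + 1) / 2) * b ^ (j (j - 1) / 2)`. Both exponents are non-negative integers, and the
divisions by `2` are exact. -/
def ramanujanTheta (a b : ℂ) : ℂ :=
  ∑' j : ℤ, a ^ (j * (j + 1) / 2) * b ^ (j * (j - 1) / 2)

/-- Ramanujan's function `ψ(q) = f(q, q ^ 3)`. -/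
def ramanujanPsi (q : ℂ) : ℂ :=
  ramanujanTheta q (q ^ 3)

end

open Filter Topology

/-! The finite Jacobi triple product (`hasSum_tripleCoeff`) expands the numerator in powers of `z`,
with coefficients `q^(j²) (q²;q²)_{2n} / ((q²;q²)_{n-j} (q²;q²)_{n+j})`. Dividing by `(q;q²)_n
(q⁴;q⁴)_n` leaves `(-q;q²)_n` of the factor `(q²;q²)_{2n}`. After exchanging sums, the sum over `n`
is a limiting `q`-Gauss series and equals `q^(j²)` times a product free of `j`
(`hasSum_sq_qFactorialRecip`). Hence the series is that product times `∑ q^(2j²) z^j`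
(`hasSum_ramanujan`). For general `m`, this is applied with `q^(m²)` and `z^m q^(4mr)`: the theta
series so obtained are the residue classes `j = km + r` of `∑ q^(2j²) z^j`
(`sum_tsum_sq_dissection`), which the triple product evaluates. -/

/-! ### Finite and infinite `q`-factorials. -/

theorem qFactorial_zero (a q : ℂ) : qFactorial a q 0 = 1 := by simp [qFactorial]

theorem qFactorial_succ (a q : ℂ) (n : ℕ) :
    qFactorial a q (n + 1) = qFactorial a q n * (1 - a * q ^ n) := by
  simp [qFactorial, Finset.prod_range_succ]

theorem qFactorial_add (a q : ℂ) (m n : ℕ) :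
    qFactorial a q (m + n) = qFactorial a q m * qFactorial (a * q ^ m) q n := by
  simp only [qFactorial, Finset.prod_range_add, pow_add, mul_assoc]

theorem qFactorial_succ' (a q : ℂ) (n : ℕ) :
    qFactorial a q (n + 1) = (1 - a) * qFactorial (a * q) q n := by
  rw [add_comm, qFactorial_add]
  simp [qFactorial]

theorem one_sub_mul_pow_ne_zero {a q : ℂ} (ha : ‖a‖ < 1) (hq : ‖q‖ < 1) (n : ℕ) :
    1 - a * q ^ n ≠ 0 := by
  intro h
  have h1 : ‖a * q ^ n‖ = 1 := by rw [← sub_eq_zero.mp h, norm_one]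
  rw [norm_mul, norm_pow] at h1
  have h2 : ‖q‖ ^ n ≤ 1 := pow_le_one₀ (norm_nonneg _) hq.le
  nlinarith [norm_nonneg a]

theorem qFactorial_ne_zero {a q : ℂ} (ha : ‖a‖ < 1) (hq : ‖q‖ < 1) (n : ℕ) :
    qFactorial a q n ≠ 0 :=
  Finset.prod_ne_zero_iff.mpr fun k _ => one_sub_mul_pow_ne_zero ha hq k

theorem tendsto_qFactorial (a : ℂ) {q : ℂ} (hq : ‖q‖ < 1) :
    Tendsto (qFactorial a q) atTop (𝓝 (qFactorialInf a q)) :=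
  (multipliable_qFactorialInf a q hq).tendsto_prod_tprod_nat

theorem qFactorialInf_ne_zero {a q : ℂ} (ha : ‖a‖ < 1) (hq : ‖q‖ < 1) :
    qFactorialInf a q ≠ 0 := by
  have h : ∏' k : ℕ, (1 + -(a * q ^ k)) ≠ 0 := by
    refine tprod_one_add_ne_zero_of_summable (f := fun k : ℕ => -(a * q ^ k)) ?_ ?_
    · intro k
      simpa [sub_eq_add_neg] using one_sub_mul_pow_ne_zero ha hq k
    · have := ((summable_geometric_of_norm_lt_one hq).mul_left a).norm
      simpa using this
  simpa [qFactorialInf, sub_eq_add_neg] using h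

theorem qFactorialInf_eq_mul (a : ℂ) {q : ℂ} (hq : ‖q‖ < 1) (m : ℕ) :
    qFactorialInf a q = qFactorial a q m * qFactorialInf (a * q ^ m) q := by
  refine tendsto_nhds_unique ((tendsto_qFactorial a hq).comp (tendsto_add_atTop_nat m)) ?_
  refine ((tendsto_qFactorial (a * q ^ m) hq).const_mul (qFactorial a q m)).congr fun n => ?_
  simp only [Function.comp, add_comm n m, qFactorial_add]

theorem exists_norm_le_of_tendsto {u : ℕ → ℂ} {l : ℂ} (h : Tendsto u atTop (𝓝 l)) :
    ∃ C : ℝ, 0 ≤ C ∧ ∀ n, ‖u n‖ ≤ C := by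
  obtain ⟨C, hC⟩ := (Metric.isBounded_range_of_tendsto u h).exists_norm_le
  exact ⟨C, (norm_nonneg _).trans (hC (u 0) ⟨0, rfl⟩), fun n => hC _ ⟨n, rfl⟩⟩

theorem exists_norm_qFactorial_le (a : ℂ) {q : ℂ} (hq : ‖q‖ < 1) :
    ∃ C : ℝ, 0 ≤ C ∧ ∀ n, ‖qFactorial a q n‖ ≤ C :=
  exists_norm_le_of_tendsto (tendsto_qFactorial a hq)

theorem exists_norm_qFactorial_inv_le {a q : ℂ} (ha : ‖a‖ < 1) (hq : ‖q‖ < 1) :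
    ∃ C : ℝ, 0 ≤ C ∧ ∀ n, ‖(qFactorial a q n)⁻¹‖ ≤ C :=
  exists_norm_le_of_tendsto ((tendsto_qFactorial a hq).inv₀ (qFactorialInf_ne_zero ha hq))

/-- Euler's even-odd splitting `(q²; q²)_{2n} = (q; q²)_n (-q; q²)_n (q⁴; q⁴)_n`. -/
theorem qFactorial_sq_two_mul (q : ℂ) (n : ℕ) :
    qFactorial (q ^ 2) (q ^ 2) (2 * n) =
      qFactorial q (q ^ 2) n * qFactorial (-q) (q ^ 2) n * qFactorial (q ^ 4) (q ^ 4) n := by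
  induction n with
  | zero => simp [qFactorial_zero]
  | succ n ih =>
    rw [show 2 * (n + 1) = 2 * n + 1 + 1 by ring, qFactorial_succ, qFactorial_succ, ih,
      qFactorial_succ, qFactorial_succ, qFactorial_succ]
    ring

theorem qFactorial_two_mul (a q : ℂ) (n : ℕ) :
    qFactorial a q (2 * n) = qFactorial a (q ^ 2) n * qFactorial (a * q) (q ^ 2) n := by
  induction n with
  | zero => simp [qFactorial_zero]
  | succ n ih =>
    rw [show 2 * (n + 1) = 2 * n + 1 + 1 by ring, qFactorial_succ, qFactorial_succ, ih,
      qFactorial_succ, qFactorial_succ]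
    ring

theorem tendsto_two_mul_atTop : Tendsto (fun n : ℕ => 2 * n) atTop atTop :=
  tendsto_id.const_mul_atTop' (by norm_num)

theorem norm_pow_lt_one {q : ℂ} (hq : ‖q‖ < 1) {n : ℕ} (hn : n ≠ 0) : ‖q ^ n‖ < 1 := by
  rw [norm_pow]
  exact pow_lt_one₀ (norm_nonneg _) hq hn

theorem qFactorialInf_sq (q : ℂ) (hq : ‖q‖ < 1) :
    qFactorialInf (q ^ 2) (q ^ 2) =
      qFactorialInf q (q ^ 2) * qFactorialInf (-q) (q ^ 2) * qFactorialInf (q ^ 4) (q ^ 4) := by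
  have h2 := norm_pow_lt_one hq two_ne_zero
  have h4 := norm_pow_lt_one hq four_ne_zero
  refine tendsto_nhds_unique ((tendsto_qFactorial (q ^ 2) h2).comp tendsto_two_mul_atTop) ?_
  refine (((tendsto_qFactorial q h2).mul (tendsto_qFactorial (-q) h2)).mul
    (tendsto_qFactorial (q ^ 4) h4)).congr fun n => ?_
  simp only [Function.comp, qFactorial_sq_two_mul]

theorem qFactorialInf_eq_mul_sq (a q : ℂ) (hq : ‖q‖ < 1) :
    qFactorialInf a q = qFactorialInf a (q ^ 2) * qFactorialInf (a * q) (q ^ 2) := by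
  have h2 := norm_pow_lt_one hq two_ne_zero
  refine tendsto_nhds_unique ((tendsto_qFactorial a hq).comp tendsto_two_mul_atTop) ?_
  refine ((tendsto_qFactorial a h2).mul (tendsto_qFactorial (a * q) h2)).congr fun n => ?_
  simp only [Function.comp, qFactorial_two_mul]

/-! ### Convergence of theta-type majorants. -/

theorem summable_pow_choose_mul_pow {r : ℝ} (hr0 : 0 ≤ r) (hr : r < 1) (x : ℝ) :
    Summable fun k : ℕ => r ^ k.choose 2 * x ^ k := by
  have h : Tendsto (fun k : ℕ => r ^ k * |x|) atTop (𝓝 0) := by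
    simpa using (tendsto_pow_atTop_nhds_zero_of_lt_one hr0 hr).mul_const |x|
  refine summable_of_ratio_norm_eventually_le (r := 1 / 2) (by norm_num) ?_
  filter_upwards [h.eventually_le_const (show (0 : ℝ) < 1 / 2 by norm_num)] with k hk
  rw [Nat.choose_succ_succ' k 1, Nat.choose_one_right]
  calc ‖r ^ (k + k.choose 2) * x ^ (k + 1)‖ = (r ^ k * |x|) * ‖r ^ k.choose 2 * x ^ k‖ := by
        simp only [norm_mul, norm_pow, Real.norm_eq_abs, abs_of_nonneg hr0, pow_add]
        ring
    _ ≤ 1 / 2 * ‖r ^ k.choose 2 * x ^ k‖ := by gcongr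

theorem sq_eq_two_mul_choose_add (k : ℕ) : k ^ 2 = 2 * k.choose 2 + k := by
  induction k with
  | zero => simp
  | succ k ih =>
    rw [Nat.choose_succ_succ' k 1, Nat.choose_one_right]
    linarith

theorem summable_pow_sq_mul_pow {r : ℝ} (hr0 : 0 ≤ r) (hr : r < 1) (x : ℝ) :
    Summable fun k : ℕ => r ^ k ^ 2 * x ^ k := by
  refine (summable_pow_choose_mul_pow (sq_nonneg r) (pow_lt_one₀ hr0 hr two_ne_zero)
    (r * x)).congr fun k => ?_
  rw [sq_eq_two_mul_choose_add, pow_add, pow_mul, mul_pow]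
  ring

theorem summable_zpow_sq_mul_zpow {r : ℝ} (hr0 : 0 ≤ r) (hr : r < 1) (x : ℝ) :
    Summable fun j : ℤ => r ^ j ^ 2 * x ^ j := by
  refine Summable.of_nat_of_neg ?_ ?_
  · refine (summable_pow_sq_mul_pow hr0 hr x).congr fun k => ?_
    norm_cast
  · refine (summable_pow_sq_mul_pow hr0 hr x⁻¹).congr fun k => ?_
    rw [neg_sq, zpow_neg, inv_pow]
    norm_cast

/-! ### The limiting `q`-Gauss sum. -/

/-- The terms of the `q`-Gauss series `₂φ₁(a, b; ad; q, d / b)` in the limit `b → ∞`. -/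
noncomputable def qGaussTerm (q a d : ℂ) (k : ℕ) : ℂ :=
  qFactorial a q k * (q ^ k.choose 2 * (-d) ^ k) * (qFactorial q q k)⁻¹ *
    (qFactorial (a * d) q k)⁻¹

/-- The shifted factorial is `(c;q)_{N+k} / (c;q)_N`, so one constant serves all `N` and `k`;
dominated convergence in `N` needs this uniformity. -/
theorem exists_norm_qFactorial_shift_inv_le {c q : ℂ} (hc : ‖c‖ < 1) (hq : ‖q‖ < 1) :
    ∃ C : ℝ, 0 ≤ C ∧ ∀ N k, ‖(qFactorial (c * q ^ N) q k)⁻¹‖ ≤ C := by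
  obtain ⟨A, hA0, hA⟩ := exists_norm_qFactorial_le c hq
  obtain ⟨B, hB0, hB⟩ := exists_norm_qFactorial_inv_le hc hq
  refine ⟨A * B, mul_nonneg hA0 hB0, fun N k => ?_⟩
  have h : (qFactorial (c * q ^ N) q k)⁻¹ = qFactorial c q N * (qFactorial c q (N + k))⁻¹ := by
    rw [qFactorial_add, mul_inv, mul_inv_cancel_left₀ (qFactorial_ne_zero hc hq N)]
  rw [h, norm_mul]
  exact mul_le_mul (hA N) (hB _) (norm_nonneg _) hA0

theorem exists_norm_qGaussTerm_le {q a d : ℂ} (hq : ‖q‖ < 1) (had : ‖a * d‖ < 1) :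
    ∃ C : ℝ, 0 ≤ C ∧ ∀ N k, ‖qGaussTerm q a (d * q ^ N) k‖ ≤
      C * (‖q‖ ^ k.choose 2 * ‖d‖ ^ k) := by
  obtain ⟨A, hA0, hA⟩ := exists_norm_qFactorial_le a hq
  obtain ⟨B, hB0, hB⟩ := exists_norm_qFactorial_inv_le hq hq
  obtain ⟨C, hC0, hC⟩ := exists_norm_qFactorial_shift_inv_le had hq
  refine ⟨A * B * C, by positivity, fun N k => ?_⟩
  have h1 : ‖q ^ k.choose 2 * (-(d * q ^ N)) ^ k‖ ≤ ‖q‖ ^ k.choose 2 * ‖d‖ ^ k := by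
    rw [norm_mul, norm_pow, norm_pow, norm_neg, norm_mul, norm_pow]
    gcongr
    exact mul_le_of_le_one_right (norm_nonneg _) (pow_le_one₀ (norm_nonneg _) hq.le)
  rw [qGaussTerm, norm_mul, norm_mul, norm_mul, ← mul_assoc a d]
  calc _ ≤ A * (‖q‖ ^ k.choose 2 * ‖d‖ ^ k) * B * C := by
        gcongr
        exacts [hA k, hB k, hC N k]
    _ = _ := by ring

theorem summable_qGaussTerm {q a d : ℂ} (hq : ‖q‖ < 1) (had : ‖a * d‖ < 1) :
    Summable (qGaussTerm q a d) := by
  obtain ⟨C, -, hC⟩ := exists_norm_qGaussTerm_le hq had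
  refine Summable.of_norm_bounded
    ((summable_pow_choose_mul_pow (norm_nonneg q) hq ‖d‖).mul_left C) fun k => ?_
  simpa using hC 0 k

theorem norm_mul_pow_lt_one {c q : ℂ} (hc : ‖c‖ < 1) (hq : ‖q‖ < 1) (n : ℕ) :
    ‖c * q ^ n‖ < 1 := by
  rw [norm_mul, norm_pow]
  exact (mul_le_of_le_one_right (norm_nonneg _)
    (pow_le_one₀ (norm_nonneg _) hq.le)).trans_lt hc

/-- A contiguous relation in `d` with telescoping right side; summed over `k`, it yields the
functional equation under `d ↦ dq`. -/
theorem qGaussTerm_sub {q a d : ℂ} (hq : ‖q‖ < 1) (had : ‖a * d‖ < 1) (k : ℕ) :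
    qGaussTerm q a d k - (1 - d) / (1 - a * d) * qGaussTerm q a (d * q) k =
      qGaussTerm q a d k * (1 - q ^ k) - qGaussTerm q a d (k + 1) * (1 - q ^ (k + 1)) := by
  have h0 : 1 - a * d ≠ 0 := by simpa using one_sub_mul_pow_ne_zero had hq 0
  have hk : 1 - a * d * q ^ k ≠ 0 := one_sub_mul_pow_ne_zero had hq k
  have hqk : 1 - q * q ^ k ≠ 0 := one_sub_mul_pow_ne_zero hq hq k
  have hF := qFactorial_ne_zero hq hq k
  have hG := qFactorial_ne_zero had hq k
  have hs : qFactorial (a * (d * q)) q k =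
      qFactorial (a * d) q k * (1 - a * d * q ^ k) / (1 - a * d) := by
    rw [← qFactorial_succ, qFactorial_succ', mul_div_cancel_left₀ _ h0, mul_assoc]
  simp only [qGaussTerm, hs, qFactorial_succ, Nat.choose_succ_succ' k 1, Nat.choose_one_right,
    Nat.reduceAdd, pow_add, pow_one, ← neg_mul, mul_pow]
  generalize q ^ k = x at *
  generalize (-d) ^ k = y
  have hxq : 1 - x * q ≠ 0 := mul_comm q x ▸ hqk
  field_simp
  ring

theorem tsum_qGaussTerm_eq_mul {q a d : ℂ} (hq : ‖q‖ < 1) (had : ‖a * d‖ < 1) :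
    ∑' k, qGaussTerm q a d k = (1 - d) / (1 - a * d) * ∑' k, qGaussTerm q a (d * q) k := by
  have hS := summable_qGaussTerm hq had
  have had' : ‖a * (d * q)‖ < 1 := by
    simpa [mul_assoc] using norm_mul_pow_lt_one had hq 1
  have hS' := (summable_qGaussTerm hq had').mul_left ((1 - d) / (1 - a * d))
  have hV : Summable fun k => qGaussTerm q a d k * (1 - q ^ k) := by
    refine Summable.of_norm_bounded (hS.norm.mul_right 2) fun k => ?_
    rw [norm_mul]
    gcongr
    refine (norm_sub_le _ _).trans ?_
    have : ‖q ^ k‖ ≤ 1 := by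
      rw [norm_pow]
      exact pow_le_one₀ (norm_nonneg _) hq.le
    rw [norm_one]
    linarith
  rw [← sub_eq_zero, ← tsum_mul_left, ← hS.tsum_sub hS']
  simp_rw [qGaussTerm_sub hq had]
  -- The telescoped sum is its term at `k = 0`, which vanishes because `1 - q^0 = 0`.
  rw [hV.tsum_sub ((summable_nat_add_iff 1).mpr hV), hV.tsum_eq_zero_add]
  simp

theorem tsum_qGaussTerm_eq_qFactorial_mul {q a d : ℂ} (hq : ‖q‖ < 1) (had : ‖a * d‖ < 1)
    (N : ℕ) :
    ∑' k, qGaussTerm q a d k = qFactorial d q N * (qFactorial (a * d) q N)⁻¹ *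
      ∑' k, qGaussTerm q a (d * q ^ N) k := by
  induction N with
  | zero => simp [qFactorial_zero]
  | succ N ih =>
    have h : ‖a * (d * q ^ N)‖ < 1 := by
      simpa [mul_assoc] using norm_mul_pow_lt_one had hq N
    rw [ih, tsum_qGaussTerm_eq_mul hq h, qFactorial_succ, qFactorial_succ, pow_succ, mul_inv,
      div_eq_mul_inv]
    simp only [mul_assoc, mul_left_comm]

/-- As `d q^N → 0`, the factor `(-d q^N)^k` kills every term except `k = 0`. -/
theorem tendsto_tsum_qGaussTerm {q a d : ℂ} (hq : ‖q‖ < 1) (had : ‖a * d‖ < 1) :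
    Tendsto (fun N : ℕ => ∑' k, qGaussTerm q a (d * q ^ N) k) atTop (𝓝 1) := by
  obtain ⟨C, hC0, hC⟩ := exists_norm_qGaussTerm_le hq had
  obtain ⟨A, hA0, hA⟩ := exists_norm_qFactorial_le a hq
  obtain ⟨B, hB0, hB⟩ := exists_norm_qFactorial_inv_le hq hq
  have key : Tendsto (fun N : ℕ => ∑' k, qGaussTerm q a (d * q ^ N) k) atTop
      (𝓝 (∑' k : ℕ, if k = 0 then 1 else 0)) := by
    refine tendsto_tsum_of_dominated_convergence
      ((summable_pow_choose_mul_pow (norm_nonneg q) hq ‖d‖).mul_left C) (fun k => ?_)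
      (Eventually.of_forall fun N k => hC N k)
    have hd : Tendsto (fun N : ℕ => d * q ^ N) atTop (𝓝 0) := by
      simpa using (tendsto_pow_atTop_nhds_zero_of_norm_lt_one hq).const_mul d
    have hcont : ContinuousAt (fun x : ℂ => qGaussTerm q a x k) 0 := by
      unfold qGaussTerm qFactorial
      refine ContinuousAt.mul (by fun_prop) (ContinuousAt.inv₀ (by fun_prop) (by simp))
    have h := hcont.tendsto.comp hd
    have h0 : qGaussTerm q a 0 k = if k = 0 then 1 else 0 := by
      rcases k with _ | k <;> simp [qGaussTerm, qFactorial_zero]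
    rw [← h0]
    exact h
  simpa using key

/-- The limiting case `b → ∞` of the `q`-Gauss summation. -/
theorem hasSum_qGaussTerm {q a d : ℂ} (hq : ‖q‖ < 1) (had : ‖a * d‖ < 1) :
    HasSum (qGaussTerm q a d) (qFactorialInf d q / qFactorialInf (a * d) q) := by
  convert (summable_qGaussTerm hq had).hasSum using 1
  have h := ((tendsto_qFactorial d hq).mul
    ((tendsto_qFactorial (a * d) hq).inv₀ (qFactorialInf_ne_zero had hq))).mul
    (tendsto_tsum_qGaussTerm hq had)
  rw [mul_one, ← div_eq_mul_inv] at h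
  refine tendsto_nhds_unique h (tendsto_const_nhds.congr fun N => ?_)
  exact tsum_qGaussTerm_eq_qFactorial_mul hq had N

/-! ### The Jacobi triple product, finite and infinite. -/

/-- The reciprocal `1 / (q; q)_k`, extended by zero to negative integers `k`. -/
noncomputable def qFactorialRecip (q : ℂ) (k : ℤ) : ℂ :=
  if 0 ≤ k then (qFactorial q q k.toNat)⁻¹ else 0

theorem qFactorialRecip_natCast (q : ℂ) (k : ℕ) :
    qFactorialRecip q k = (qFactorial q q k)⁻¹ := by
  simp [qFactorialRecip]

theorem qFactorialRecip_of_neg (q : ℂ) {k : ℤ} (hk : k < 0) : qFactorialRecip q k = 0 := by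
  simp [qFactorialRecip, hk]

/-- Extension by zero is consistent with the recurrence: at `k = 0` the factor `1 - q^k` vanishes.
Later algebra thus needs no cases on the range of `j`. -/
theorem qFactorialRecip_sub_one {q : ℂ} (hq : ‖q‖ < 1) (k : ℤ) :
    qFactorialRecip q (k - 1) = (1 - q ^ k) * qFactorialRecip q k := by
  rcases lt_trichotomy k 0 with hk | rfl | hk
  · rw [qFactorialRecip_of_neg q hk, qFactorialRecip_of_neg q (by lia), mul_zero]
  · rw [qFactorialRecip_of_neg q (by lia)]
    simp
  · obtain ⟨n, rfl⟩ : ∃ n : ℕ, k = (n + 1 : ℕ) := ⟨(k - 1).toNat, by lia⟩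
    rw [show ((n + 1 : ℕ) : ℤ) - 1 = n by simp, qFactorialRecip_natCast, qFactorialRecip_natCast,
      qFactorial_succ, zpow_natCast, pow_succ', mul_inv, mul_comm,
      inv_mul_cancel_right₀ (one_sub_mul_pow_ne_zero hq hq n)]

theorem exists_norm_qFactorialRecip_le {q : ℂ} (hq : ‖q‖ < 1) :
    ∃ C : ℝ, 0 ≤ C ∧ ∀ k, ‖qFactorialRecip q k‖ ≤ C := by
  obtain ⟨C, hC0, hC⟩ := exists_norm_qFactorial_inv_le hq hq
  refine ⟨C, hC0, fun k => ?_⟩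
  rw [qFactorialRecip]
  split_ifs
  · exact hC _
  · simpa using hC0

theorem tendsto_qFactorialRecip {q : ℂ} (hq : ‖q‖ < 1) :
    Tendsto (qFactorialRecip q) atTop (𝓝 (qFactorialInf q q)⁻¹) := by
  have h := ((tendsto_qFactorial q hq).inv₀ (qFactorialInf_ne_zero hq hq)).comp
    (show Tendsto Int.toNat atTop atTop from
      tendsto_atTop_atTop.mpr fun b => ⟨b, fun k hk => by lia⟩)
  refine h.congr' ?_
  filter_upwards [eventually_ge_atTop 0] with k hk
  simp [qFactorialRecip, hk]

/-- The coefficient of `z ^ j` in `(-zq; q²)_n (-q/z; q²)_n`. -/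
noncomputable def tripleCoeff (q : ℂ) (n : ℕ) (j : ℤ) : ℂ :=
  q ^ j ^ 2 * (qFactorial (q ^ 2) (q ^ 2) (2 * n) *
    (qFactorialRecip (q ^ 2) (n - j) * qFactorialRecip (q ^ 2) (n + j)))

/-- Coefficient form of multiplication by `(1 + z q^(2n+1)) (1 + q^(2n+1)/z)`. -/
theorem tripleCoeff_succ {q : ℂ} (hq0 : q ≠ 0) (hq : ‖q‖ < 1) (n : ℕ) (j : ℤ) :
    tripleCoeff q (n + 1) j = (1 + q ^ (4 * n + 2)) * tripleCoeff q n j +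
      q ^ (2 * n + 1) * (tripleCoeff q n (j - 1) + tripleCoeff q n (j + 1)) := by
  have h2 := norm_pow_lt_one hq two_ne_zero
  have hQ0 : q ^ 2 ≠ 0 := pow_ne_zero _ hq0
  have hu := qFactorialRecip_sub_one h2 (n + 1 - j)
  have hu' := qFactorialRecip_sub_one h2 (n - j)
  have hv := qFactorialRecip_sub_one h2 (n + 1 + j)
  have hv' := qFactorialRecip_sub_one h2 (n + j)
  rw [show (n + 1 - j - 1 : ℤ) = n - j by ring] at hu
  rw [show (n + 1 + j - 1 : ℤ) = n + j by ring] at hv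
  simp only [tripleCoeff, show 2 * (n + 1) = 2 * n + 1 + 1 by ring, qFactorial_succ,
    Nat.cast_add, Nat.cast_one]
  rw [show (n - (j - 1) : ℤ) = n + 1 - j by ring, show (n + (j - 1) : ℤ) = n + j - 1 by ring,
    show (n - (j + 1) : ℤ) = n - j - 1 by ring, show (n + (j + 1) : ℤ) = n + 1 + j by ring,
    hu', hv', hu, hv]
  have e1 : q ^ (j - 1) ^ 2 = q ^ j ^ 2 * ((q ^ 2) ^ j)⁻¹ * q := by
    rw [show (j - 1) ^ 2 = j ^ 2 - 2 * j + 1 by ring, zpow_add₀ hq0, zpow_sub₀ hq0, zpow_one,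
      zpow_mul, div_eq_mul_inv]
    norm_cast
  have e2 : q ^ (j + 1) ^ 2 = q ^ j ^ 2 * (q ^ 2) ^ j * q := by
    rw [show (j + 1) ^ 2 = j ^ 2 + 2 * j + 1 by ring, zpow_add₀ hq0, zpow_add₀ hq0, zpow_one,
      zpow_mul]
    norm_cast
  rw [e1, e2]
  have hx : (q ^ 2) ^ j ≠ 0 := zpow_ne_zero _ hQ0
  simp only [zpow_add₀ hQ0, zpow_sub₀ hQ0, zpow_natCast, zpow_one]
  have e3 : q ^ (4 * n + 2) = ((q ^ 2) ^ n) ^ 2 * q ^ 2 := by ring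
  have e4 : q ^ (2 * n + 1) = (q ^ 2) ^ n * q := by ring
  have e5 : (q ^ 2) ^ (2 * n) = ((q ^ 2) ^ n) ^ 2 := by ring
  have e6 : (q ^ 2) ^ (2 * n + 1) = ((q ^ 2) ^ n) ^ 2 * q ^ 2 := by ring
  rw [e3, e4, e5, e6]
  generalize (q ^ 2) ^ j = x at *
  generalize (q ^ 2) ^ n = y
  field_simp
  ring

/-- The finite form of the Jacobi triple product identity. -/
theorem hasSum_tripleCoeff {q z : ℂ} (hq0 : q ≠ 0) (hq : ‖q‖ < 1) (hz : z ≠ 0) (n : ℕ) :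
    HasSum (fun j : ℤ => tripleCoeff q n j * z ^ j)
      (qFactorial (-(z * q)) (q ^ 2) n * qFactorial (-q / z) (q ^ 2) n) := by
  induction n with
  | zero =>
    simp only [qFactorial_zero, mul_one]
    convert hasSum_ite_eq (0 : ℤ) (1 : ℂ) using 2 with j
    rcases lt_trichotomy j 0 with hj | rfl | hj
    · simp [tripleCoeff, qFactorialRecip_of_neg _ hj, hj.ne]
    · simp [tripleCoeff, qFactorialRecip, qFactorial_zero]
    · simp [tripleCoeff, qFactorialRecip_of_neg _ (neg_neg_of_pos hj), hj.ne']
  | succ n ih =>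
    have h1 := ((Equiv.subRight (1 : ℤ)).hasSum_iff.mpr ih).mul_left z
    have h2 := ((Equiv.addRight (1 : ℤ)).hasSum_iff.mpr ih).mul_left z⁻¹
    have h := (ih.mul_left (1 + q ^ (4 * n + 2))).add ((h1.add h2).mul_left (q ^ (2 * n + 1)))
    convert h using 1
    · rfl
    · funext j
      simp only [Function.comp, Equiv.subRight_apply, Equiv.coe_addRight,
        tripleCoeff_succ hq0 hq, zpow_add₀ hz, zpow_sub₀ hz, zpow_one]
      field_simp
    · rw [qFactorial_succ, qFactorial_succ]
      field_simp
      ring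

theorem summable_zpow_sq_mul_zpow_complex {q : ℂ} (hq : ‖q‖ < 1) (z : ℂ) :
    Summable fun j : ℤ => ‖q ^ j ^ 2 * z ^ j‖ := by
  simpa [norm_mul, norm_zpow] using summable_zpow_sq_mul_zpow (norm_nonneg q) hq ‖z‖

/-- The Jacobi triple product identity. -/
theorem hasSum_jacobi_triple {q z : ℂ} (hq0 : q ≠ 0) (hq : ‖q‖ < 1) (hz : z ≠ 0) :
    HasSum (fun j : ℤ => q ^ j ^ 2 * z ^ j)
      (qFactorialInf (-(z * q)) (q ^ 2) * qFactorialInf (-q / z) (q ^ 2) *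
        qFactorialInf (q ^ 2) (q ^ 2)) := by
  have h2 := norm_pow_lt_one hq two_ne_zero
  have hS := summable_zpow_sq_mul_zpow_complex hq z
  obtain ⟨A, hA0, hA⟩ := exists_norm_qFactorial_le (q ^ 2) h2
  obtain ⟨B, hB0, hB⟩ := exists_norm_qFactorialRecip_le h2
  have hne := qFactorialInf_ne_zero h2 h2
  have key : Tendsto (fun n : ℕ => ∑' j : ℤ, tripleCoeff q n j * z ^ j) atTop
      (𝓝 (∑' j : ℤ, q ^ j ^ 2 * z ^ j * (qFactorialInf (q ^ 2) (q ^ 2))⁻¹)) := by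
    -- `A` bounds `(q²;q²)_{2n}` and each `B` bounds one reciprocal, uniformly in `n` and `j`.
    refine tendsto_tsum_of_dominated_convergence (hS.mul_right (A * (B * B))) (fun j => ?_)
      (Eventually.of_forall fun n j => ?_)
    · have hc : Tendsto (fun n : ℕ => (n : ℤ)) atTop atTop := tendsto_natCast_atTop_atTop
      have t1 := (tendsto_qFactorialRecip h2).comp (tendsto_atTop_add_const_right _ (-j) hc)
      have t2 := (tendsto_qFactorialRecip h2).comp (tendsto_atTop_add_const_right _ j hc)
      have t3 := (tendsto_qFactorial (q ^ 2) h2).comp tendsto_two_mul_atTop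
      have t := ((t3.mul (t1.mul t2)).const_mul (q ^ j ^ 2)).mul_const (z ^ j)
      rw [mul_inv_cancel_left₀ hne, mul_right_comm] at t
      exact t
    · rw [tripleCoeff, mul_right_comm, norm_mul, norm_mul (qFactorial _ _ _),
        norm_mul (qFactorialRecip _ _)]
      gcongr
      exacts [hA _, hB _, hB _]
  rw [tsum_mul_right] at key
  have lim := (tendsto_qFactorial (-(z * q)) h2).mul (tendsto_qFactorial (-q / z) h2)
  have e := tendsto_nhds_unique (key.congr fun n => (hasSum_tripleCoeff hq0 hq hz n).tsum_eq) lim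
  rw [← e, inv_mul_cancel_right₀ hne]
  exact hS.of_norm.hasSum

/-! ### Ramanujan's identity by exchange of summation. -/

/-- Terms with `n < J` vanish; with `n = J + k` the rest is the `q`-Gauss series in base `q²` with
`a = d = -q^(2J+1)`. -/
theorem hasSum_sq_qFactorialRecip_natCast {q : ℂ} (hq : ‖q‖ < 1) (J : ℕ) :
    HasSum (fun n : ℕ => q ^ n ^ 2 * qFactorial (-q) (q ^ 2) n *
        (qFactorialRecip (q ^ 2) (n - J) * qFactorialRecip (q ^ 2) (n + J)))
      (q ^ J ^ 2 * (qFactorialInf (-q) (q ^ 2) / qFactorialInf (q ^ 2) (q ^ 2))) := by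
  have h2 := norm_pow_lt_one hq two_ne_zero
  have hprod : -q * (q ^ 2) ^ J * (-q * (q ^ 2) ^ J) = q ^ 2 * (q ^ 2) ^ (2 * J) := by ring
  have hc : ‖-q * (q ^ 2) ^ J * (-q * (q ^ 2) ^ J)‖ < 1 :=
    hprod ▸ norm_mul_pow_lt_one h2 h2 _
  rw [← (add_right_injective J).hasSum_iff]
  · have h := (hasSum_qGaussTerm h2 hc).mul_left
      (q ^ J ^ 2 * qFactorial (-q) (q ^ 2) J * (qFactorial (q ^ 2) (q ^ 2) (2 * J))⁻¹)
    rw [hprod] at h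
    convert h using 1
    · rfl
    · funext k
      simp only [Function.comp, qGaussTerm, hprod]
      rw [show ((J + k : ℕ) : ℤ) - J = (k : ℕ) by push_cast; ring,
        show ((J + k : ℕ) : ℤ) + J = (2 * J + k : ℕ) by push_cast; ring,
        qFactorialRecip_natCast, qFactorialRecip_natCast, qFactorial_add, qFactorial_add, mul_inv,
        show (J + k) ^ 2 = J ^ 2 + 2 * J * k + k ^ 2 by ring, sq_eq_two_mul_choose_add k]
      ring
    · rw [qFactorialInf_eq_mul (-q) h2 J, qFactorialInf_eq_mul (q ^ 2) h2 (2 * J)]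
      simp only [div_eq_mul_inv, mul_inv]
      ring
  · intro n hn
    have hlt : n < J := by
      by_contra h
      exact hn ⟨n - J, by lia⟩
    rw [qFactorialRecip_of_neg _ (show (n - J : ℤ) < 0 by lia)]
    simp

theorem hasSum_sq_qFactorialRecip {q : ℂ} (hq : ‖q‖ < 1) (j : ℤ) :
    HasSum (fun n : ℕ => q ^ n ^ 2 * qFactorial (-q) (q ^ 2) n *
        (qFactorialRecip (q ^ 2) (n - j) * qFactorialRecip (q ^ 2) (n + j)))
      (q ^ j ^ 2 * (qFactorialInf (-q) (q ^ 2) / qFactorialInf (q ^ 2) (q ^ 2))) := by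
  obtain ⟨J, rfl | rfl⟩ := j.eq_nat_or_neg
  · have h := hasSum_sq_qFactorialRecip_natCast hq J
    exact_mod_cast h
  · have h := hasSum_sq_qFactorialRecip_natCast hq J
    simp only [sub_neg_eq_add, ← sub_eq_add_neg, neg_sq]
    simp only [mul_comm (qFactorialRecip (q ^ 2) (_ + _))]
    exact_mod_cast h

/-- Ramanujan's identity, with the theta function in product form. -/
theorem hasSum_ramanujan {q z : ℂ} (hq0 : q ≠ 0) (hq : ‖q‖ < 1) (hz : z ≠ 0) :
    HasSum (fun n : ℕ => q ^ n ^ 2 *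
        (qFactorial (-(z * q)) (q ^ 2) n * qFactorial (-q / z) (q ^ 2) n) /
        (qFactorial q (q ^ 2) n * qFactorial (q ^ 4) (q ^ 4) n))
      ((∑' j : ℤ, (q ^ 2) ^ j ^ 2 * z ^ j) *
        (qFactorialInf (-q) (q ^ 2) / qFactorialInf (q ^ 2) (q ^ 2))) := by
  have h2 := norm_pow_lt_one hq two_ne_zero
  obtain ⟨A, hA0, hA⟩ := exists_norm_qFactorial_le (-q) h2
  obtain ⟨B, hB0, hB⟩ := exists_norm_qFactorialRecip_le h2
  -- Summing over `j` first gives the series in question; summing over `n` first gives the theta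
  -- series.
  set t : ℤ × ℕ → ℂ := fun p => q ^ p.1 ^ 2 * z ^ p.1 *
    (q ^ p.2 ^ 2 * qFactorial (-q) (q ^ 2) p.2 *
      (qFactorialRecip (q ^ 2) (p.2 - p.1) * qFactorialRecip (q ^ 2) (p.2 + p.1))) with ht
  have hS : Summable t := by
    have hn : Summable fun n : ℕ => ‖q‖ ^ n ^ 2 := by
      simpa using summable_pow_sq_mul_pow (norm_nonneg q) hq 1
    have hs := ((summable_zpow_sq_mul_zpow_complex hq z).mul_of_nonneg (hn.mul_right (A * (B * B)))
      (fun _ => norm_nonneg _) (fun _ => by positivity))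
    refine Summable.of_norm_bounded hs fun p => ?_
    simp only [ht]
    rw [norm_mul, norm_mul (_ * _) (_ * _), norm_mul (q ^ p.2 ^ 2), norm_pow q,
      norm_mul (qFactorialRecip _ _), mul_assoc (‖q‖ ^ p.2 ^ 2)]
    gcongr
    exacts [hA _, hB _, hB _]
  have hcol (j : ℤ) := (hasSum_sq_qFactorialRecip hq j).mul_left (q ^ j ^ 2 * z ^ j)
  have hrow (n : ℕ) : HasSum (fun j : ℤ => t (j, n)) (q ^ n ^ 2 *
      (qFactorial (-(z * q)) (q ^ 2) n * qFactorial (-q / z) (q ^ 2) n) /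
        (qFactorial q (q ^ 2) n * qFactorial (q ^ 4) (q ^ 4) n)) := by
    have h := (hasSum_tripleCoeff hq0 hq hz n).mul_left
      (q ^ n ^ 2 / (qFactorial q (q ^ 2) n * qFactorial (q ^ 4) (q ^ 4) n))
    have h4 := norm_pow_lt_one hq four_ne_zero
    have n1 := qFactorial_ne_zero hq h2 n
    have n2 := qFactorial_ne_zero h4 h4 n
    convert h using 1
    · rfl
    · funext j
      simp only [ht, tripleCoeff, qFactorial_sq_two_mul]
      field_simp
    · ring
  have hsum := hS.hasSum.prod_fiberwise hcol
  have e : ∑' p, t p = (∑' j : ℤ, (q ^ 2) ^ j ^ 2 * z ^ j) *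
      (qFactorialInf (-q) (q ^ 2) / qFactorialInf (q ^ 2) (q ^ 2)) := by
    rw [← hsum.tsum_eq, ← tsum_mul_right]
    refine tsum_congr fun j => ?_
    rw [pow_two q, mul_zpow]
    ring
  rw [← e]
  exact ((Equiv.prodComm ℕ ℤ).hasSum_iff.mpr hS.hasSum).prod_fiberwise hrow

theorem tsum_sq_eq_qFactorialInf {q z : ℂ} (hq0 : q ≠ 0) (hq : ‖q‖ < 1) (hz : z ≠ 0) :
    ∑' j : ℤ, (q ^ 2) ^ j ^ 2 * z ^ j =
      qFactorialInf (-(z * q ^ 2)) (q ^ 4) * qFactorialInf (-q ^ 2 / z) (q ^ 4) *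
        qFactorialInf (q ^ 4) (q ^ 4) := by
  have h := (hasSum_jacobi_triple (pow_ne_zero 2 hq0) (norm_pow_lt_one hq two_ne_zero) hz).tsum_eq
  rwa [← pow_mul] at h

/-! ### Dissection modulo `m` and theta functions. -/

/-- The dissection of the theta series modulo `m`. -/
theorem sum_tsum_sq_dissection {q z : ℂ} (hq0 : q ≠ 0) (hq : ‖q‖ < 1) (hz : z ≠ 0) {m : ℕ}
    (hm : 1 ≤ m) :
    ∑ r ∈ Finset.range m, q ^ (2 * r ^ 2) * z ^ r *
        ∑' k : ℤ, ((q ^ m ^ 2) ^ 2) ^ k ^ 2 * (z ^ m * q ^ (4 * m * r)) ^ k =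
      ∑' j : ℤ, (q ^ 2) ^ j ^ 2 * z ^ j := by
  have : NeZero m := ⟨by lia⟩
  have hS : Summable fun j : ℤ => (q ^ 2) ^ j ^ 2 * z ^ j :=
    (summable_zpow_sq_mul_zpow_complex (norm_pow_lt_one hq two_ne_zero) z).of_norm
  have h1 := ((Int.divModEquiv m).symm.hasSum_iff.mpr hS.hasSum)
  have h2 := ((Equiv.prodComm (Fin m) ℤ).hasSum_iff.mpr h1)
  rw [← Fin.sum_univ_eq_sum_range (fun r => q ^ (2 * r ^ 2) * z ^ r *
        ∑' k : ℤ, ((q ^ m ^ 2) ^ 2) ^ k ^ 2 * (z ^ m * q ^ (4 * m * r)) ^ k)]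
  rw [← h2.tsum_eq, h2.summable.tsum_prod, tsum_fintype]
  refine Finset.sum_congr rfl fun r _ => ?_
  rw [← tsum_mul_left]
  refine tsum_congr fun k => ?_
  simp only [Function.comp, Equiv.prodComm_apply, Prod.swap, Int.divModEquiv_symm_apply]
  have hz' : z ^ (k * m + (r : ℕ) : ℤ) = z ^ (r : ℕ) * (z ^ m) ^ k := by
    rw [zpow_add₀ hz, mul_comm k, zpow_mul, zpow_natCast, zpow_natCast, mul_comm]
  -- `2(km + r)² = 2r² + 2m²k² + 4mrk`; the cross term is the source of `q^(4mr)`.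
  have hq' : (q ^ 2) ^ (k * m + (r : ℕ) : ℤ) ^ 2 =
      q ^ (2 * (r : ℕ) ^ 2) * ((q ^ m ^ 2) ^ 2) ^ k ^ 2 * (q ^ (4 * m * (r : ℕ))) ^ k := by
    simp only [← zpow_natCast, ← zpow_mul, ← zpow_add₀ hq0]
    congr 1
    push_cast
    ring
  rw [hz', hq', mul_zpow]
  ring

theorem ramanujanTheta_eq_tsum {q z : ℂ} (hq0 : q ≠ 0) (hz : z ≠ 0) :
    ramanujanTheta (z * q) (q / z) = ∑' j : ℤ, q ^ j ^ 2 * z ^ j := by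
  refine tsum_congr fun j => ?_
  obtain ⟨s, hs⟩ := (Int.even_mul_succ_self j).two_dvd
  have h1 : j * (j + 1) / 2 = s := by lia
  have h2 : j * (j - 1) / 2 = s - j := by
    rw [show j * (j - 1) = 2 * (s - j) by linarith]
    lia
  have h3 : j ^ 2 = s + (s - j) := by linarith
  rw [h1, h2, h3, mul_zpow, div_zpow, zpow_add₀ hq0, zpow_sub₀ hz]
  have := zpow_ne_zero s hz
  have := zpow_ne_zero j hz
  field_simp

theorem ramanujanPsi_neg {q : ℂ} (hq0 : q ≠ 0) (hq : ‖q‖ < 1) :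
    ramanujanPsi (-q) = qFactorialInf q (q ^ 2) * qFactorialInf (q ^ 4) (q ^ 4) := by
  have h2 := norm_pow_lt_one hq two_ne_zero
  -- With `z = -1/q`, `f(zq², q²/z)` becomes `f(-q, (-q)³) = ψ(-q)`.
  have hz : (-q)⁻¹ ≠ 0 := inv_ne_zero (neg_ne_zero.mpr hq0)
  have e1 : (-q)⁻¹ * q ^ 2 = -q := by field_simp
  have e2 : q ^ 2 / (-q)⁻¹ = (-q) ^ 3 := by field_simp
  rw [ramanujanPsi, ← e2]
  nth_rewrite 1 [← e1]
  rw [ramanujanTheta_eq_tsum (pow_ne_zero 2 hq0) hz, tsum_sq_eq_qFactorialInf hq0 hq hz, e1,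
    neg_div, e2, qFactorialInf_eq_mul_sq q (q ^ 2) h2, neg_neg, ← pow_mul,
    show -(-q) ^ 3 = q * q ^ 2 by ring]

theorem mainTheorem7 (z q : ℂ) (hz : z ≠ 0) (hq0 : q ≠ 0) (hq : ‖q‖ < 1) :
    (∀ m : ℕ, 1 ≤ m →
      (∀ r ∈ Finset.range m, Summable fun n : ℕ =>
        q ^ (m ^ 2 * n ^ 2) *
            (qFactorial (-(q ^ (m ^ 2) * z ^ m * q ^ (4 * m * r))) (q ^ (2 * m ^ 2)) n *
              qFactorial (-q ^ (m ^ 2) / (z ^ m * q ^ (4 * m * r))) (q ^ (2 * m ^ 2)) n) /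
          (qFactorial (q ^ (m ^ 2)) (q ^ (2 * m ^ 2)) n *
            qFactorial (q ^ (4 * m ^ 2)) (q ^ (4 * m ^ 2)) n)) ∧
      ∑ r ∈ Finset.range m, q ^ (2 * r ^ 2) * z ^ r *
          ∑' n : ℕ,
            q ^ (m ^ 2 * n ^ 2) *
                (qFactorial (-(q ^ (m ^ 2) * z ^ m * q ^ (4 * m * r))) (q ^ (2 * m ^ 2)) n *
                  qFactorial (-q ^ (m ^ 2) / (z ^ m * q ^ (4 * m * r))) (q ^ (2 * m ^ 2)) n) /
              (qFactorial (q ^ (m ^ 2)) (q ^ (2 * m ^ 2)) n *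
                qFactorial (q ^ (4 * m ^ 2)) (q ^ (4 * m ^ 2)) n) =
        (qFactorialInf (-(z * q ^ 2)) (q ^ 4) * qFactorialInf (-q ^ 2 / z) (q ^ 4) *
            qFactorialInf (q ^ 4) (q ^ 4)) *
          (qFactorialInf (-q ^ (m ^ 2)) (q ^ (2 * m ^ 2)) /
            qFactorialInf (q ^ (2 * m ^ 2)) (q ^ (2 * m ^ 2)))) ∧
    HasSum
      (fun n : ℕ =>
        q ^ (n ^ 2) * qFactorial (-(z * q)) (q ^ 2) n * qFactorial (-q / z) (q ^ 2) n /
          (qFactorial q (q ^ 2) n * qFactorial (q ^ 4) (q ^ 4) n))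
      (ramanujanTheta (z * q ^ 2) (q ^ 2 / z) / ramanujanPsi (-q)) := by
  constructor
  · intro m hm
    have hm2 : m ^ 2 ≠ 0 := pow_ne_zero 2 (by lia)
    have key (r : ℕ) := hasSum_ramanujan (z := z ^ m * q ^ (4 * m * r)) (pow_ne_zero (m ^ 2) hq0)
      (norm_pow_lt_one hq hm2) (mul_ne_zero (pow_ne_zero _ hz) (pow_ne_zero _ hq0))
    have c1 (r : ℕ) : z ^ m * q ^ (4 * m * r) * q ^ m ^ 2 = q ^ m ^ 2 * z ^ m * q ^ (4 * m * r) := by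
      ring
    have c2 : (q ^ m ^ 2) ^ 2 = q ^ (2 * m ^ 2) := by rw [← pow_mul, mul_comm]
    have c4 : (q ^ m ^ 2) ^ 4 = q ^ (4 * m ^ 2) := by rw [← pow_mul, mul_comm]
    have hd := sum_tsum_sq_dissection hq0 hq hz hm
    simp only [c1, c2, c4, ← pow_mul q (m ^ 2)] at key hd
    refine ⟨fun r _ => (key r).summable, ?_⟩
    simp only [fun r => (key r).tsum_eq]
    simp only [← mul_assoc _ _ (_ / _)]
    rw [← Finset.sum_mul, ← tsum_sq_eq_qFactorialInf hq0 hq hz, ← hd]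
  · have h2 := norm_pow_lt_one hq two_ne_zero
    have h4 := norm_pow_lt_one hq four_ne_zero
    have n1 : qFactorialInf (-q) (q ^ 2) ≠ 0 := qFactorialInf_ne_zero (by simpa using hq) h2
    have n2 := qFactorialInf_ne_zero hq h2
    have n3 := qFactorialInf_ne_zero h4 h4
    have h := hasSum_ramanujan hq0 hq hz
    simp only [← mul_assoc] at h
    rw [ramanujanTheta_eq_tsum (pow_ne_zero 2 hq0) hz, ramanujanPsi_neg hq0 hq]
    convert h using 1
    -- Euler's splitting turns `(-q;q²)_∞ / (q²;q²)_∞` into `1 / ψ(-q)`.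
    rw [qFactorialInf_sq q hq]
    field_simp
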